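/- **Setting.** Let $\mathcal X,\mathcal Y,\mathcal Z$ be real Hilbert spaces, $A:\mathcal X\to\mathcal Z$ and $B:\mathcal Y\to\mathcal Z$ continuous linear operators, and $b\in\mathcal Z$. For a function $h:\mathcal H\to\mathbb R\cup\{+\infty\}$ on a real Hilbert space put $\partial h(u)=\{w: h(v)\ge h(u)+\langle w,v-u\rangle\ \forall v\}$. For $\mu\ge 0$ let $\mathcal S^0_\mu(\mathcal H)$ be the set of proper, convex, lower semicontinuous $h:\mathcal H\to\mathbb R\cup\{+\infty\}$ with $h(u_1)-h(u_2)-\langle w,u_1-u_2\rangle\ge\frac{\mu}{2}\|u_1-u_2\|^2$ for all $u_1,u_2\in\mathcal H$ and $w\in\partial h(u_2)$. Let $f\in\mathcal S^0_{\mu_f}(\mathcal X)$ and $g\in\mathcal S^0_{\mu_g}(\mathcal Y)$ with $\mu_f,\mu_g\ge 0$, and let $\mathbb S$ be the set of optimal solutions of $$\min_{x,y}\ f(x)+g(y)\quad\text{s.t.}\quad Ax+By=b .$$ Let $\mathcal L(x,y,\lambda)=f(x)+g(y)+\langle\lambda,Ax+By-b\rangle$ and $\mathcal L_\theta(x,y,\lambda)=\mathcal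 L(x,y,\lambda)+\frac\theta2\|Ax+By-b\|^2$. Assume that $\mathcal L$ has a saddle point $(x^*,y^*,\lambda^*)$, that is, $\mathcal L(x^*,y^*,\lambda)\le\mathcal L(x^*,y^*,\lambda^*)\le\mathcal L(x,y,\lambda^*)$ for all $(x,y,\lambda)$. On $\mathcal X\times\mathcal Y$ use the norm $\|(x,y)\|=\sqrt{\|x\|^2+\|y\|^2}$. **Parameters.** Let $\delta,\gamma>0$ with $\delta\gamma-1\ge 0$, and let $(\alpha_k)_{k\ge1}$, $(\beta_k)_{k\ge1}$, $(\epsilon_k)_{k\ge1}$ be real sequences such that $\alpha_k>0$, $\beta_k>0$, $(\beta_k)$ is nondecreasing with $\beta_k\to+\infty$, and $\delta\beta_{k+1}\le\delta\beta_k+\alpha_k\beta_k$ for all $k\ge1$. Assume that $(\epsilon_k)$ is nonincreasing, $\sum_{k\ge1}\alpha_k\epsilon_k<+\infty$ and $\beta_k\epsilon_k\to+\infty$. **Algorithm.** Let $x_1=x_0=\frac1\gamma Z_1$, $y_1=y_0=\frac1\gamma H_1$, $\lambda_1=\lambda_0$, and for $k=1,2,\dots$ put $\theta_k=(\alpha_k+\delta)\beta_k$,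 $\eta_{f,k}=\gamma+\frac1{\alpha_k}+\mu_f\delta\beta_k$, $\eta_{g,k}=\gamma+\frac1{\alpha_k}+\mu_g\delta\beta_k$, $\widetilde\lambda_k=\lambda_k-\delta\beta_k(Ax_k+By_k-b)$, $\widetilde x_k=x_k+\frac{Z_k-\gamma x_k}{\eta_{f,k}}$, $\widetilde y_k=y_k+\frac{H_k-\gamma y_k}{\eta_{g,k}}$, let $$(x_{k+1},y_{k+1})=\mathop{\arg\min}_{(x,y)\in\mathcal X\times\mathcal Y}\Big(\mathcal L_{\theta_k}(x,y,\widetilde\lambda_k)+\tfrac{\eta_{f,k}}{2\alpha_k\beta_k}\|x-\widetilde x_k\|^2+\tfrac{\eta_{g,k}}{2\alpha_k\beta_k}\|y-\widetilde y_k\|^2+\tfrac{\epsilon_k}2\|x\|^2+\tfrac{\epsilon_k}2\|y\|^2\Big),$$ and then $Z_{k+1}=(\gamma+\frac1{\alpha_k})x_{k+1}-\frac1{\alpha_k}x_k$, $H_{k+1}=(\gamma+\frac1{\alpha_k})y_{k+1}-\frac1{\alpha_k}y_k$, $Z^\delta_{k+1}=\delta Z_{k+1}+(1-\delta\gamma)x_{k+1}$,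 $H^\delta_{k+1}=\delta H_{k+1}+(1-\delta\gamma)y_{k+1}$, $\lambda_{k+1}=\lambda_k+\alpha_k\beta_k(AZ^\delta_{k+1}+BH^\delta_{k+1}-b)$. **Theorem.** The set $\mathbb S$ has a unique element $(\bar x^*,\bar y^*)$ of minimal norm, and $$\liminf_{k\to+\infty}\|(x_k,y_k)-(\bar x^*,\bar y^*)\|=0 .$$ If, moreover, there is an integer $K\ge1$ such that either $(x_k,y_k)$ lies in the open ball with center $0$ and radius $\|(\bar x^*,\bar y^*)\|$ for all $k\ge K$, or $(x_k,y_k)$ lies outside this open ball for all $k\ge K$, then $$\lim_{k\to+\infty}\|(x_k,y_k)-(\bar x^*,\bar y^*)\|=0 .$$ -/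

import Mathlib

open Filter Topology

noncomputable section

namespace PrimalDualJoint

/-- Proper convex lower semicontinuous functions with values in `ℝ ∪ {+∞}`: the value `⊥` is
never taken, `⊤` is not the only value, the epigraph is convex, and `f` is lower semicontinuous. -/
structure IsProperConvexLsc {E : Type*} [NormedAddCommGroup E] [InnerProductSpace ℝ E]
    (f : E → EReal) : Prop where
  ne_bot : ∀ x, f x ≠ ⊥
  exists_ne_top : ∃ x, f x ≠ ⊤
  convex_epigraph : Convex ℝ {p : E × ℝ | f p.1 ≤ (p.2 : EReal)}
  lsc : LowerSemicontinuous f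

/-- The convex subdifferential `∂f(x)`. For proper `f` it is empty where `f x = ⊤`. -/
def subdifferential {E : Type*} [NormedAddCommGroup E] [InnerProductSpace ℝ E]
    (f : E → EReal) (x : E) : Set E :=
  {v | ∀ z, f x + ((inner ℝ v (z - x) : ℝ) : EReal) ≤ f z}

/-- The class `S⁰_μ`: proper convex lower semicontinuous functions such that
`f(x₁) - f(x₂) - ⟪w, x₁ - x₂⟫ ≥ (μ/2) ‖x₁ - x₂‖²` for all `x₁`, `x₂` and all `w ∈ ∂f(x₂)`. -/
structure InClassS {E : Type*} [NormedAddCommGroup E] [InnerProductSpace ℝ E]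
    (μ : ℝ) (f : E → EReal) : Prop extends IsProperConvexLsc f where
  strong : ∀ x₁ x₂, ∀ w ∈ subdifferential f x₂,
    f x₂ + ((inner ℝ w (x₁ - x₂) + μ / 2 * ‖x₁ - x₂‖ ^ 2 : ℝ) : EReal) ≤ f x₁

/-- The set of optimal solutions of `min f(x) + g(y)` subject to `A x + B y = b`. -/
def solutionSet {X Y Z : Type*}
    [NormedAddCommGroup X] [InnerProductSpace ℝ X] [NormedAddCommGroup Y] [InnerProductSpace ℝ Y]
    [NormedAddCommGroup Z] [InnerProductSpace ℝ Z]
    (f : X → EReal) (g : Y → EReal) (A : X →L[ℝ] Z) (B : Y →L[ℝ] Z) (b : Z) : Set (X × Y) :=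
  {p | A p.1 + B p.2 = b ∧ ∀ x y, A x + B y = b → f p.1 + g p.2 ≤ f x + g y}

/-- `p` is a solution of minimal norm, for the Hilbert norm
`‖(x, y)‖ = √(‖x‖² + ‖y‖²)` of the product. -/
def IsMinNormSolution {X Y Z : Type*}
    [NormedAddCommGroup X] [InnerProductSpace ℝ X] [NormedAddCommGroup Y] [InnerProductSpace ℝ Y]
    [NormedAddCommGroup Z] [InnerProductSpace ℝ Z]
    (f : X → EReal) (g : Y → EReal) (A : X →L[ℝ] Z) (B : Y →L[ℝ] Z) (b : Z)
    (p : X × Y) : Prop :=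
  p ∈ solutionSet f g A B b ∧
    ∀ q ∈ solutionSet f g A B b, ‖WithLp.toLp 2 p‖ ≤ ‖WithLp.toLp 2 q‖

/-- The Lagrangian `f(x) + g(y) + ⟪l, A x + B y - b⟫`. -/
def lagrangian {X Y Z : Type*}
    [NormedAddCommGroup X] [InnerProductSpace ℝ X] [NormedAddCommGroup Y] [InnerProductSpace ℝ Y]
    [NormedAddCommGroup Z] [InnerProductSpace ℝ Z]
    (f : X → EReal) (g : Y → EReal) (A : X →L[ℝ] Z) (B : Y →L[ℝ] Z) (b : Z)
    (x : X) (y : Y) (l : Z) : EReal :=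
  f x + g y + ((inner ℝ l (A x + B y - b) : ℝ) : EReal)

/-- The augmented Lagrangian with penalty parameter `θ`. -/
def augLagrangian {X Y Z : Type*}
    [NormedAddCommGroup X] [InnerProductSpace ℝ X] [NormedAddCommGroup Y] [InnerProductSpace ℝ Y]
    [NormedAddCommGroup Z] [InnerProductSpace ℝ Z]
    (f : X → EReal) (g : Y → EReal) (A : X →L[ℝ] Z) (B : Y →L[ℝ] Z) (b : Z) (θ : ℝ)
    (x : X) (y : Y) (l : Z) : EReal :=
  lagrangian f g A B b x y l + ((θ / 2 * ‖A x + B y - b‖ ^ 2 : ℝ) : EReal)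

/-- Saddle points of the Lagrangian. -/
def IsSaddlePoint {X Y Z : Type*}
    [NormedAddCommGroup X] [InnerProductSpace ℝ X] [NormedAddCommGroup Y] [InnerProductSpace ℝ Y]
    [NormedAddCommGroup Z] [InnerProductSpace ℝ Z]
    (f : X → EReal) (g : Y → EReal) (A : X →L[ℝ] Z) (B : Y →L[ℝ] Z) (b : Z)
    (xs : X) (ys : Y) (ls : Z) : Prop :=
  (∀ l, lagrangian f g A B b xs ys l ≤ lagrangian f g A B b xs ys ls) ∧
    ∀ x y, lagrangian f g A B b xs ys ls ≤ lagrangian f g A B b x y ls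

/-- The function minimized in one step of the joint primal-dual algorithm, with step size `α`,
scale `β` and regularization `ε`, when the current state is `x, y, l` with velocities `Zv, Hv`. -/
def stepObjective {X Y Z : Type*}
    [NormedAddCommGroup X] [InnerProductSpace ℝ X] [NormedAddCommGroup Y] [InnerProductSpace ℝ Y]
    [NormedAddCommGroup Z] [InnerProductSpace ℝ Z]
    (f : X → EReal) (g : Y → EReal) (A : X →L[ℝ] Z) (B : Y →L[ℝ] Z) (b : Z)
    (μf μg δ γ α β ε : ℝ) (x : X) (y : Y) (l : Z) (Zv : X) (Hv : Y) (p : X × Y) : EReal :=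
  let θ : ℝ := (α + δ) * β
  let ηf : ℝ := γ + 1 / α + μf * δ * β
  let ηg : ℝ := γ + 1 / α + μg * δ * β
  let l' : Z := l - (δ * β) • (A x + B y - b)
  let x' : X := x + (1 / ηf) • (Zv - γ • x)
  let y' : Y := y + (1 / ηg) • (Hv - γ • y)
  augLagrangian f g A B b θ p.1 p.2 l' +
    ((ηf / (2 * α * β) * ‖p.1 - x'‖ ^ 2 + ηg / (2 * α * β) * ‖p.2 - y'‖ ^ 2
      + ε / 2 * ‖p.1‖ ^ 2 + ε / 2 * ‖p.2‖ ^ 2 : ℝ) : EReal)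

/-- The sequences `x, y, l, Zs, Hs, Zd, Hd` (the last two are `Z^δ, H^δ`) are generated by the
joint primal-dual algorithm. Only the parameters `α k, β k, ε k` with `k ≥ 1` are used. -/
structure IsJointAlgorithm {X Y Z : Type*}
    [NormedAddCommGroup X] [InnerProductSpace ℝ X] [NormedAddCommGroup Y] [InnerProductSpace ℝ Y]
    [NormedAddCommGroup Z] [InnerProductSpace ℝ Z]
    (f : X → EReal) (g : Y → EReal) (A : X →L[ℝ] Z) (B : Y →L[ℝ] Z) (b : Z)
    (μf μg δ γ : ℝ) (α β ε : ℕ → ℝ)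
    (x : ℕ → X) (y : ℕ → Y) (l : ℕ → Z)
    (Zs : ℕ → X) (Hs : ℕ → Y) (Zd : ℕ → X) (Hd : ℕ → Y) : Prop where
  init_x : x 1 = x 0 ∧ x 0 = (1 / γ) • Zs 1
  init_y : y 1 = y 0 ∧ y 0 = (1 / γ) • Hs 1
  init_l : l 1 = l 0
  argmin : ∀ k, 1 ≤ k →
    IsMinOn (stepObjective f g A B b μf μg δ γ (α k) (β k) (ε k) (x k) (y k) (l k) (Zs k) (Hs k))
      Set.univ (x (k + 1), y (k + 1))
  step_Z : ∀ k, 1 ≤ k → Zs (k + 1) = (γ + 1 / α k) • x (k + 1) - (1 / α k) • x k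
  step_H : ∀ k, 1 ≤ k → Hs (k + 1) = (γ + 1 / α k) • y (k + 1) - (1 / α k) • y k
  step_Zd : ∀ k, 1 ≤ k → Zd (k + 1) = δ • Zs (k + 1) + (1 - δ * γ) • x (k + 1)
  step_Hd : ∀ k, 1 ≤ k → Hd (k + 1) = δ • Hs (k + 1) + (1 - δ * γ) • y (k + 1)
  step_l : ∀ k, 1 ≤ k → l (k + 1) = l k + (α k * β k) • (A (Zd (k + 1)) + B (Hd (k + 1)) - b)

end PrimalDualJoint

end

/-!
Write `u = (x, y)`, `r k = A (x k) + B (y k) - b` and `φ k` for the gap between the Lagrangian at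
the `k`-th iterate (with the multiplier `ls` of the saddle point) and its saddle value.

The optimality conditions of one step form an implicit scheme in which the multiplier is exactly the
updated one (`IsJointAlgorithm.optimality`). Testing the scheme with a solution `p` and with the
previous iterate yields an energy estimate (`IsJointAlgorithm.exists_energy`). It is used twice, as
`energy_step_of_level` makes precise:

* With the regularization term `ε k / 2 * ‖u k‖ ^ 2` the energy is nonnegative and increases by at
  most a multiple of `α k * β k * ε k`. As `α k * ε k` is summable, Kronecker's argument
  (`tendsto_div_zero_of_le_add`) shows that the energy is `o(β k)`. Hence `φ k → 0`; and since the
  multipliers are `o(√β k)`, also `r k → 0`: up to a shift by the multiplier, `δ * β k * r k`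
  evolves by convex combinations (`tendsto_residual_zero`).
* With `ε k / 2 * (‖u k‖ ^ 2 - ‖p‖ ^ 2)` the energy does not increase while `‖p‖ ≤ ‖u k‖`. If that
  holds eventually, `β k * ε k * (‖u k‖ ^ 2 - ‖p‖ ^ 2)` stays bounded above, and
  `β k * ε k → ∞` forces `limsup ‖u k‖ ≤ ‖p‖`.

Let `p` now be the solution of minimal norm. The iterates enter every set of near-optimal points
(`nearOptimalSet`); these are closed, convex and nested, and their intersection is the solution set.
Along any filter on which `limsup ‖u k‖ ≤ ‖p‖`, comparison with the projections of the origin onto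
these sets therefore gives strong convergence to `p` (`tendsto_of_eventually_mem_nested`), without
recourse to weak compactness. If
the iterates visit the ball of radius `‖p‖` infinitely often, this applies along these visits;
otherwise they are eventually outside it, and the second use of the energy applies.
-/

namespace PrimalDualJoint

/-! ### Nested convex sets and points of minimal norm -/

section Geometry
variable {H : Type*} [NormedAddCommGroup H] [InnerProductSpace ℝ H] [CompleteSpace H]

/-- The point of minimal norm in a closed convex set, with the variational inequality of the
projection of the origin in Pythagorean form. -/
theorem exists_norm_sub_sq_le {C : Set H} (hne : C.Nonempty) (hcl : IsClosed C)
    (hcv : Convex ℝ C) :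
    ∃ q ∈ C, ∀ z ∈ C, ‖z - q‖ ^ 2 ≤ ‖z‖ ^ 2 - ‖q‖ ^ 2 := by
  obtain ⟨q, hq, hmin⟩ := exists_norm_eq_iInf_of_complete_convex hne hcl.isComplete hcv 0
  refine ⟨q, hq, fun z hz => ?_⟩
  have h := (norm_eq_iInf_iff_real_inner_le_zero hcv hq).1 hmin z hz
  have h1 := norm_sub_sq_real z q
  rw [zero_sub, inner_neg_left, inner_sub_right, real_inner_self_eq_norm_sq,
    real_inner_comm] at h
  linarith

/-- A family that eventually enters each of a decreasing sequence of closed convex sets, and whose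
norm is asymptotically at most that of the point `p` of minimal norm in their intersection,
converges strongly to `p`. -/
theorem tendsto_of_eventually_mem_nested {ι : Type*} {φ : Filter ι} {C : ℕ → Set H}
    (hanti : Antitone C) (hcl : ∀ n, IsClosed (C n)) (hcv : ∀ n, Convex ℝ (C n))
    {p : H} (hp : ∀ n, p ∈ C n) (hmin : ∀ q, (∀ n, q ∈ C n) → ‖p‖ ≤ ‖q‖)
    {u : ι → H} (hu : ∀ n, ∀ᶠ k in φ, u k ∈ C n)
    (hnorm : ∀ η > 0, ∀ᶠ k in φ, ‖u k‖ ^ 2 ≤ ‖p‖ ^ 2 + η) :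
    Tendsto u φ (𝓝 p) := by
  choose q hq hproj using fun n => exists_norm_sub_sq_le ⟨p, hp n⟩ (hcl n) (hcv n)
  have hle : ∀ n, ‖q n‖ ^ 2 ≤ ‖p‖ ^ 2 := fun n => by
    have := hproj n p (hp n)
    nlinarith [sq_nonneg ‖p - q n‖]
  have hmono : Monotone fun n => ‖q n‖ ^ 2 := fun m n hmn => by
    have := hproj m (q n) (hanti hmn (hq n))
    have h2 := sq_nonneg ‖q n - q m‖
    simp only
    linarith
  have hconv := tendsto_atTop_ciSup hmono ⟨‖p‖ ^ 2, by rintro _ ⟨n, rfl⟩; exact hle n⟩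
  have hcauchy : CauchySeq q := by
    rw [Metric.cauchySeq_iff']
    intro e he
    obtain ⟨N, hN⟩ := Metric.cauchySeq_iff'.1 hconv.cauchySeq (e ^ 2) (by positivity)
    refine ⟨N, fun n hn => ?_⟩
    have h1 := hproj N (q n) (hanti hn (hq n))
    have h2 := hN n hn
    rw [Real.dist_eq] at h2
    have h3 := (le_abs_self _).trans_lt h2
    rw [dist_eq_norm]
    exact lt_of_pow_lt_pow_left₀ 2 he.le (h1.trans_lt h3)
  obtain ⟨q', hq'⟩ := cauchySeq_tendsto_of_complete hcauchy
  have hmem : ∀ n, q' ∈ C n := fun n =>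
    (hcl n).mem_of_tendsto hq' ((eventually_ge_atTop n).mono fun m hm => hanti hm (hq m))
  have hq'p : ‖q'‖ ^ 2 ≤ ‖p‖ ^ 2 :=
    le_of_tendsto (hq'.norm.pow 2) (Eventually.of_forall hle)
  have hpq' : ‖p‖ ^ 2 ≤ ‖q'‖ ^ 2 := by
    have := hmin q' hmem
    gcongr
  -- The projections `q n` of the origin converge in norm to `‖p‖`, hence they converge to `p`.
  have hlim : Tendsto (fun n => ‖q n‖ ^ 2) atTop (𝓝 (‖p‖ ^ 2)) := by
    have := hq'.norm.pow 2
    rwa [le_antisymm hq'p hpq'] at this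
  rw [Metric.tendsto_nhds]
  intro e he
  obtain ⟨n, hn⟩ := ((tendsto_order.1 hlim).1 (‖p‖ ^ 2 - e ^ 2 / 16)
    (by have : 0 < e ^ 2 := by positivity
        linarith)).exists
  filter_upwards [hu n, hnorm (e ^ 2 / 16) (by positivity)] with k hk1 hk2
  have h1 := hproj n (u k) hk1
  have h2 := hproj n p (hp n)
  have h3 : ‖u k - q n‖ < e / 2 := by
    refine lt_of_pow_lt_pow_left₀ 2 (by positivity) ?_
    have : 0 < e ^ 2 := by positivity
    linarith [show (e / 2) ^ 2 = e ^ 2 / 4 by ring]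
  have h4 : ‖p - q n‖ < e / 2 := by
    refine lt_of_pow_lt_pow_left₀ 2 (by positivity) ?_
    have : 0 < e ^ 2 := by positivity
    linarith [show (e / 2) ^ 2 = e ^ 2 / 4 by ring]
  rw [dist_eq_norm]
  calc ‖u k - p‖ = ‖(u k - q n) - (p - q n)‖ := by congr 1; abel
    _ ≤ ‖u k - q n‖ + ‖p - q n‖ := norm_sub_le _ _
    _ < e := by linarith

end Geometry

/-! ### Scalar and dual recursions -/

/-- Kronecker's argument: energies whose increments are bounded by `β k * c k` with `c` summable
are `o(β k)`. -/
theorem tendsto_div_zero_of_le_add {E β c : ℕ → ℝ} (hE : ∀ k, 2 ≤ k → 0 ≤ E k)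
    (hβpos : ∀ k, 1 ≤ k → 0 < β k) (hβmono : ∀ k, 1 ≤ k → β k ≤ β (k + 1))
    (hβlim : Tendsto β atTop atTop) (hc : ∀ k, 1 ≤ k → 0 ≤ c k)
    (hsum : Summable fun k => c (k + 1))
    (hstep : ∀ k, 2 ≤ k → E (k + 1) ≤ E k + β k * c k) :
    Tendsto (fun k => E k / β k) atTop (𝓝 0) := by
  have hsum' : Summable c := (summable_nat_add_iff 1).1 hsum
  have hbound : ∀ m, 2 ≤ m → ∀ n, m ≤ n → E n ≤ E m + β n * ∑ k ∈ Finset.Ico m n, c k := by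
    intro m hm n hn
    induction n, hn using Nat.le_induction with
    | base => simp
    | succ n hmn ih =>
      rw [Finset.sum_Ico_succ_top hmn]
      have h0 : 0 ≤ ∑ k ∈ Finset.Ico m n, c k :=
        Finset.sum_nonneg fun k hk => hc k (by have := (Finset.mem_Ico.1 hk).1; omega)
      have h1 := hstep n (by omega)
      have h2 := hβmono n (by omega)
      have h3 := hc n (by omega)
      nlinarith
  rw [Metric.tendsto_nhds]
  intro e he
  obtain ⟨N, hN⟩ := Metric.cauchySeq_iff'.1 hsum'.hasSum.tendsto_sum_nat.cauchySeq (e / 4)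
    (by positivity)
  set m := max N 2
  have hβm : ∀ᶠ n in atTop, E m / (e / 2) + 1 ≤ β n := hβlim.eventually_ge_atTop _
  filter_upwards [hβm, eventually_ge_atTop m] with n hn1 hn2
  have hm2 : 2 ≤ m := le_max_right _ _
  have hβn := hβpos n (by omega)
  have h1 := hbound m hm2 n hn2
  have h2 : ∑ k ∈ Finset.Ico m n, c k < e / 2 := by
    rw [Finset.sum_Ico_eq_sub _ hn2]
    have ha := hN n (le_trans (le_max_left _ _) hn2)
    have hb := hN m (le_max_left _ _)
    rw [Real.dist_eq, abs_lt] at ha hb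
    linarith [ha.2, hb.1]
  have h3 : E m < e / 2 * β n := by
    have : E m / (e / 2) < β n := by linarith
    rwa [div_lt_iff₀ (by positivity), mul_comm] at this
  rw [Real.dist_eq, sub_zero, abs_of_nonneg (div_nonneg (hE n (by omega)) hβn.le),
    div_lt_iff₀ hβn]
  nlinarith

/-- If the multipliers `m k`, driven by the residuals `r k`, satisfy `‖m k‖ = O(√β k)`, then
`δ * β k * ‖r k‖ = O(√β k)`, and the residuals tend to zero. -/
theorem tendsto_residual_zero {Z : Type*} [NormedAddCommGroup Z] [NormedSpace ℝ Z]
    {r m : ℕ → Z} {α β : ℕ → ℝ} {δ M : ℝ} (hδ : 0 < δ)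
    (hβpos : ∀ k, 1 ≤ k → 0 < β k) (hβmono : ∀ k, 1 ≤ k → β k ≤ β (k + 1))
    (hβlim : Tendsto β atTop atTop) (hαpos : ∀ k, 1 ≤ k → 0 < α k)
    (hαβ : ∀ k, 1 ≤ k → δ * β (k + 1) ≤ δ * β k + α k * β k)
    (hstep : ∀ k, 2 ≤ k →
      m (k + 1) - m k = ((α k + δ) * β k) • r (k + 1) - (δ * β k) • r k)
    (hm : ∀ k, 2 ≤ k → ‖m k‖ ^ 2 ≤ M * β k) :
    Tendsto r atTop (𝓝 0) := by
  have hm' : ∀ k, 2 ≤ k → ‖m k‖ ≤ √M * √(β k) := fun k hk => by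
    rw [← Real.sqrt_mul' _ (hβpos k (by omega)).le]
    exact Real.le_sqrt_of_sq_le (hm k hk)
  set D : ℝ := max (√M) (‖(δ * β 2) • r 2 - m 2‖ / √(β 2))
  have hD : √M ≤ D := le_max_left _ _
  have ht : ∀ k, 2 ≤ k → ‖(δ * β k) • r k - m k‖ ≤ D * √(β k) := by
    intro k hk
    induction k, hk using Nat.le_induction with
    | base =>
      rw [← div_le_iff₀ (Real.sqrt_pos.2 (hβpos 2 (by omega)))]
      exact le_max_right _ _
    | succ k hk ih =>
      have hβ := hβpos k (by omega)
      have hα := hαpos k (by omega)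
      have hβ' := hβpos (k + 1) (by omega)
      set q : ℝ := δ * β (k + 1) / ((α k + δ) * β k) with hq
      have hden : 0 < (α k + δ) * β k := by positivity
      have hq0 : 0 ≤ q := by positivity
      have hq1 : q ≤ 1 := by
        rw [hq, div_le_one hden]
        linarith [hαβ k (by omega)]
      have hqe : q * ((α k + δ) * β k) = δ * β (k + 1) := by
        rw [hq]; field_simp
      have hr : ((α k + δ) * β k) • r (k + 1) = m (k + 1) - m k + (δ * β k) • r k := by
        rw [hstep k hk]; abel
      -- The new vector is a convex combination of the old one and `-m (k + 1)`.
      have hcomb : (δ * β (k + 1)) • r (k + 1) - m (k + 1) =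
          q • ((δ * β k) • r k - m k) - (1 - q) • m (k + 1) := by
        rw [← hqe, mul_smul, hr]
        module
      have hsq : √(β k) ≤ √(β (k + 1)) := Real.sqrt_le_sqrt (hβmono k (by omega))
      have hD0 : 0 ≤ D := (Real.sqrt_nonneg M).trans hD
      have h1 : ‖(δ * β k) • r k - m k‖ ≤ D * √(β (k + 1)) :=
        ih.trans (by gcongr)
      have h2 : ‖m (k + 1)‖ ≤ D * √(β (k + 1)) :=
        (hm' (k + 1) (by omega)).trans (by gcongr)
      rw [hcomb]
      calc _ ≤ ‖q • ((δ * β k) • r k - m k)‖ + ‖(1 - q) • m (k + 1)‖ := norm_sub_le _ _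
        _ = q * ‖(δ * β k) • r k - m k‖ + (1 - q) * ‖m (k + 1)‖ := by
          rw [norm_smul, norm_smul, Real.norm_of_nonneg hq0,
            Real.norm_of_nonneg (sub_nonneg.2 hq1)]
        _ ≤ q * (D * √(β (k + 1))) + (1 - q) * (D * √(β (k + 1))) := by
          have := sub_nonneg.2 hq1
          gcongr
        _ = D * √(β (k + 1)) := by ring
  have hlim : Tendsto (fun k => (D + √M) / δ / √(β k)) atTop (𝓝 0) :=
    (Real.tendsto_sqrt_atTop.comp hβlim).const_div_atTop _
  refine squeeze_zero_norm' ?_ hlim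
  filter_upwards [eventually_ge_atTop 2] with k hk
  have hβ := hβpos k (by omega)
  have h1 : ‖(δ * β k) • r k‖ ≤ (D + √M) * √(β k) := by
    calc _ = ‖((δ * β k) • r k - m k) + m k‖ := by rw [sub_add_cancel]
      _ ≤ ‖(δ * β k) • r k - m k‖ + ‖m k‖ := norm_add_le _ _
      _ ≤ D * √(β k) + √M * √(β k) := add_le_add (ht k hk) (hm' k hk)
      _ = _ := by ring
  rw [norm_smul, Real.norm_of_nonneg (by positivity)] at h1
  have hs := Real.sqrt_pos.2 hβ
  rw [div_div, le_div_iff₀ (by positivity)]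
  have h2 : (‖r k‖ * (δ * √(β k))) * √(β k) ≤ (D + √M) * √(β k) := by
    calc _ = δ * (√(β k) * √(β k)) * ‖r k‖ := by ring
      _ = δ * β k * ‖r k‖ := by rw [Real.mul_self_sqrt hβ.le]
      _ ≤ _ := h1
  exact le_of_mul_le_mul_right h2 hs

/-! ### Optimality conditions and the energy of one block -/

section Block
variable {E : Type*} [NormedAddCommGroup E] [InnerProductSpace ℝ E]

theorem IsProperConvexLsc.exists_coe {f : E → EReal} (hf : IsProperConvexLsc f) {x : E}
    (hx : f x ≠ ⊤) : ∃ a : ℝ, f x = a :=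
  ⟨(f x).toReal, (EReal.coe_toReal hx (hf.ne_bot x)).symm⟩

/-- Convexity of the epigraph as Jensen's inequality for real upper bounds of the values. -/
theorem IsProperConvexLsc.le_combo {f : E → EReal} (hf : IsProperConvexLsc f) {x z : E}
    {a c : ℝ} (hx : f x ≤ a) (hz : f z ≤ c) {s t : ℝ} (hs : 0 ≤ s) (ht : 0 ≤ t)
    (hst : s + t = 1) : f (s • x + t • z) ≤ ((s * a + t * c : ℝ) : EReal) :=
  hf.convex_epigraph (x := (x, a)) hx (y := (z, c)) hz hs ht hst

/-- First-order optimality: if `x` minimizes `f + Q` and `Q` is quadratic along every ray from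
`x`, with slope given by `-w`, then `w` is a subgradient of `f` at `x`. -/
theorem mem_subdifferential_of_forall_le {f : E → EReal} (hf : IsProperConvexLsc f) {x w : E}
    (hx : f x ≠ ⊤) (Q c : E → ℝ) (hmin : ∀ z, f x + (Q x : EReal) ≤ f z + (Q z : EReal))
    (hQ : ∀ z, ∀ t : ℝ, Q (x + t • (z - x)) = Q x - t * inner ℝ w (z - x) + t ^ 2 * c z) :
    w ∈ subdifferential f x := by
  intro z
  obtain ⟨a, ha⟩ := hf.exists_coe hx
  by_cases hz : f z = ⊤
  · rw [hz]; exact le_top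
  obtain ⟨d, hd⟩ := hf.exists_coe hz
  have key : ∀ t : ℝ, 0 < t → t ≤ 1 → inner ℝ w (z - x) ≤ d - a + t * c z := by
    intro t ht0 ht1
    have h1 := hf.le_combo ha.le hd.le (sub_nonneg.2 ht1) ht0.le (sub_add_cancel _ _)
    have hpt : (1 - t) • x + t • z = x + t • (z - x) := by module
    rw [hpt] at h1
    have h2 := (hmin (x + t • (z - x))).trans (add_le_add_left h1 _)
    rw [ha, hQ z t] at h2
    norm_cast at h2
    have h3 : t * inner ℝ w (z - x) ≤ t * (d - a + t * c z) := by linarith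
    exact le_of_mul_le_mul_left h3 ht0
  have hlim : Tendsto (fun t : ℝ => d - a + t * c z) (𝓝[>] 0) (𝓝 (d - a + 0 * c z)) :=
    ((continuous_const.add (continuous_id.mul continuous_const)).tendsto' _ _ rfl).mono_left
      nhdsWithin_le_nhds
  have h4 : inner ℝ w (z - x) ≤ d - a + 0 * c z := by
    refine ge_of_tendsto hlim ?_
    filter_upwards [Ioc_mem_nhdsGT (zero_lt_one (α := ℝ))] with t ht using key t ht.1 ht.2
  rw [ha, hd]
  norm_cast
  linarith

/-- The optimality condition in one block variable of the step objective, the other block being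
absorbed into the constant `c`. -/
theorem mem_subdifferential_of_block_min {Z : Type*} [NormedAddCommGroup Z]
    [InnerProductSpace ℝ Z] [CompleteSpace E] [CompleteSpace Z] {f : E → EReal}
    (hf : IsProperConvexLsc f) {x x' : E} (hx : f x ≠ ⊤) (A : E →L[ℝ] Z) (c l' : Z)
    (θ ρ ε : ℝ)
    (hmin : ∀ z, f x + ((inner ℝ l' (A x + c) + θ / 2 * ‖A x + c‖ ^ 2 + ρ / 2 * ‖x - x'‖ ^ 2
        + ε / 2 * ‖x‖ ^ 2 : ℝ) : EReal) ≤
      f z + ((inner ℝ l' (A z + c) + θ / 2 * ‖A z + c‖ ^ 2 + ρ / 2 * ‖z - x'‖ ^ 2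
        + ε / 2 * ‖z‖ ^ 2 : ℝ) : EReal)) :
    -(A.adjoint (l' + θ • (A x + c)) + ρ • (x - x') + ε • x) ∈ subdifferential f x := by
  refine mem_subdifferential_of_forall_le hf hx
    (fun z => inner ℝ l' (A z + c) + θ / 2 * ‖A z + c‖ ^ 2 + ρ / 2 * ‖z - x'‖ ^ 2
        + ε / 2 * ‖z‖ ^ 2)
    (fun z => θ / 2 * ‖A (z - x)‖ ^ 2 + ρ / 2 * ‖z - x‖ ^ 2 + ε / 2 * ‖z - x‖ ^ 2) hmin ?_
  intro z t
  generalize z - x = d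
  have e1 : A (x + t • d) + c = (A x + c) + t • A d := by
    rw [map_add, map_smul]; abel
  have e2 : x + t • d - x' = (x - x') + t • d := by abel
  simp only [e1, e2]
  simp only [norm_add_sq_real, norm_smul, inner_smul_right, inner_add_right, inner_neg_left,
    inner_add_left, inner_smul_left, ContinuousLinearMap.adjoint_inner_left, mul_pow,
    Real.norm_eq_abs, sq_abs, RCLike.conj_to_real]
  ring

/-- The change of the primal energy in one block. The cross term with `a`, the image of the
updated multiplier under the adjoint, is left over to cancel against the dual energy. -/
theorem block_energy_step {x0 x1 Z0 Z1 V0 V1 p ξ a : E} {μ δ γ α β β' ε f0 f1 fp : ℝ}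
    (hμ : 0 ≤ μ) (hδ : 0 < δ) (hδγ : 0 ≤ δ * γ - 1) (hα : 0 < α) (hβ : 0 < β) (hε : 0 ≤ ε)
    (hβ' : δ * β' ≤ δ * β + α * β)
    (hZ : Z1 - Z0 = -((μ * δ * β) • (x1 - x0)) - (α * β) • (ξ + a + ε • x1))
    (hV0 : V0 = δ • Z0 + (1 - δ * γ) • x0) (hV1 : V1 = δ • Z1 + (1 - δ * γ) • x1)
    (hV1' : V1 = x1 + (δ / α) • (x1 - x0))
    (hp : f1 + (inner ℝ ξ (p - x1) + μ / 2 * ‖p - x1‖ ^ 2) ≤ fp)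
    (h0 : f1 + (inner ℝ ξ (x0 - x1) + μ / 2 * ‖x0 - x1‖ ^ 2) ≤ f0) :
    (1 / 2 * ‖V1 - p‖ ^ 2 + (δ * γ - 1 + δ ^ 2 * β' * μ) / 2 * ‖x1 - p‖ ^ 2)
      - (1 / 2 * ‖V0 - p‖ ^ 2 + (δ * γ - 1 + δ ^ 2 * β * μ) / 2 * ‖x0 - p‖ ^ 2) ≤
    -(δ * α * β) * (f1 - fp + ε / 2 * (‖x1‖ ^ 2 - ‖p‖ ^ 2))
      - δ ^ 2 * β * (f1 - f0 + ε / 2 * (‖x1‖ ^ 2 - ‖x0‖ ^ 2))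
      - δ * α * β * inner ℝ a (V1 - p) := by
  obtain ⟨e, he⟩ : ∃ e, e = x1 - p := ⟨_, rfl⟩
  obtain ⟨d, hd⟩ : ∃ d, d = x1 - x0 := ⟨_, rfl⟩
  obtain ⟨n, hn⟩ : ∃ n, n = ξ + a + ε • x1 := ⟨_, rfl⟩
  have hW : V1 - p = e + (δ / α) • d := by rw [hV1', he, hd]; abel
  have hDV : V1 - V0 = (1 - δ * γ - μ * δ ^ 2 * β) • d - (δ * α * β) • n := by
    have : V1 - V0 = δ • (Z1 - Z0) + (1 - δ * γ) • (x1 - x0) := by rw [hV0, hV1]; module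
    rw [this, hZ, hd, hn]; module
  have hV0n : ‖V0 - p‖ ^ 2 = ‖V1 - p‖ ^ 2 - 2 * inner ℝ (V1 - V0) (V1 - p) + ‖V1 - V0‖ ^ 2 := by
    have : V0 - p = (V1 - p) - (V1 - V0) := by abel
    rw [this, norm_sub_sq_real, real_inner_comm]
  have hx0 : ‖x0 - p‖ ^ 2 = ‖e‖ ^ 2 - 2 * inner ℝ d e + ‖d‖ ^ 2 := by
    have : x0 - p = e - d := by rw [he, hd]; abel
    rw [this, norm_sub_sq_real, real_inner_comm]
  have hin : inner ℝ (V1 - V0) (V1 - p) = (1 - δ * γ - μ * δ ^ 2 * β) *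
      (inner ℝ d e + δ / α * ‖d‖ ^ 2) - δ * α * β * (inner ℝ n e) - δ ^ 2 * β * inner ℝ n d := by
    rw [hDV, hW]
    simp only [inner_sub_left, inner_add_right, inner_smul_left, inner_smul_right,
      RCLike.conj_to_real, real_inner_self_eq_norm_sq]
    field_simp
    ring
  have hne : inner ℝ n e = inner ℝ ξ e + inner ℝ a e
      + ε / 2 * (‖x1‖ ^ 2 - ‖p‖ ^ 2 + ‖e‖ ^ 2) := by
    have : ‖p‖ ^ 2 = ‖x1‖ ^ 2 - 2 * inner ℝ x1 e + ‖e‖ ^ 2 := by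
      rw [← norm_sub_sq_real, he]; congr 2; abel
    rw [hn, inner_add_left, inner_add_left, inner_smul_left, RCLike.conj_to_real, this]; ring
  have hnd : inner ℝ n d = inner ℝ ξ d + inner ℝ a d
      + ε / 2 * (‖x1‖ ^ 2 - ‖x0‖ ^ 2 + ‖d‖ ^ 2) := by
    have : ‖x0‖ ^ 2 = ‖x1‖ ^ 2 - 2 * inner ℝ x1 d + ‖d‖ ^ 2 := by
      rw [← norm_sub_sq_real, hd]; congr 2; abel
    rw [hn, inner_add_left, inner_add_left, inner_smul_left, RCLike.conj_to_real, this]; ring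
  have hain : δ * α * β * inner ℝ a (V1 - p) =
      δ * α * β * inner ℝ a e + δ ^ 2 * β * inner ℝ a d := by
    rw [hW, inner_add_right, inner_smul_right]; field_simp
  rw [← neg_sub, inner_neg_right, norm_neg, ← he] at hp
  rw [← neg_sub, inner_neg_right, norm_neg, ← hd] at h0
  rw [hV0n, hx0, hin, hain, hne, hnd, ← he]
  have k1 := mul_le_mul_of_nonneg_left hp (show 0 ≤ δ * α * β by positivity)
  have k0 := mul_le_mul_of_nonneg_left h0 (show 0 ≤ δ ^ 2 * β by positivity)
  have kβ := mul_le_mul_of_nonneg_left hβ' (show 0 ≤ δ * μ / 2 * ‖e‖ ^ 2 by positivity)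
  have s1 : 0 ≤ (δ * γ - 1) * (δ / α) * ‖d‖ ^ 2 := by positivity
  have s2 : 0 ≤ (δ * γ - 1) * ‖d‖ ^ 2 := by positivity
  have s3 : 0 ≤ μ * δ ^ 2 * β * (δ / α) * ‖d‖ ^ 2 := by positivity
  have s4 : 0 ≤ μ * δ ^ 2 * β * ‖d‖ ^ 2 := by positivity
  have s5 : 0 ≤ δ * α * β * ε * ‖e‖ ^ 2 := by positivity
  have s6 : 0 ≤ δ ^ 2 * β * ε * ‖d‖ ^ 2 := by positivity
  have s7 : 0 ≤ ‖V1 - V0‖ ^ 2 := by positivity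
  linarith

end Block

section Product
variable {X Y Z : Type*}
  [NormedAddCommGroup X] [InnerProductSpace ℝ X] [NormedAddCommGroup Y] [InnerProductSpace ℝ Y]
  [NormedAddCommGroup Z] [InnerProductSpace ℝ Z]
  {f : X → EReal} {g : Y → EReal} {A : X →L[ℝ] Z} {B : Y →L[ℝ] Z} {b : Z}

/-! ### Saddle points and near-optimal sets -/

theorem ne_top_of_add_coe_ne_top (hf : IsProperConvexLsc f) (hg : IsProperConvexLsc g)
    {x : X} {y : Y} {c : ℝ} (h : f x + g y + (c : EReal) ≠ ⊤) : f x ≠ ⊤ ∧ g y ≠ ⊤ := by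
  constructor <;> intro hx <;> apply h
  · rw [hx, EReal.top_add_of_ne_bot (hg.ne_bot y), EReal.top_add_coe]
  · rw [hx, EReal.add_top_of_ne_bot (hf.ne_bot x), EReal.top_add_coe]

/-- A saddle point is feasible, and the optimal value is a real number that bounds the Lagrangian
from below at the dual component. -/
theorem IsSaddlePoint.exists_value (hf : IsProperConvexLsc f) (hg : IsProperConvexLsc g)
    {xs : X} {ys : Y} {ls : Z} (h : IsSaddlePoint f g A B b xs ys ls) :
    ∃ v : ℝ, f xs + g ys = v ∧ A xs + B ys = b ∧
      ∀ x y, (v : EReal) ≤ lagrangian f g A B b x y ls := by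
  obtain ⟨x0, hx0⟩ := hf.exists_ne_top
  obtain ⟨y0, hy0⟩ := hg.exists_ne_top
  obtain ⟨a0, ha0⟩ := hf.exists_coe hx0
  obtain ⟨c0, hc0⟩ := hg.exists_coe hy0
  have hfin : lagrangian f g A B b xs ys ls ≠ ⊤ := by
    refine ne_top_of_le_ne_top ?_ (h.2 x0 y0)
    rw [lagrangian, ha0, hc0]
    exact_mod_cast EReal.coe_ne_top _
  obtain ⟨hx, hy⟩ := ne_top_of_add_coe_ne_top hf hg hfin
  obtain ⟨a, ha⟩ := hf.exists_coe hx
  obtain ⟨c, hc⟩ := hg.exists_coe hy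
  have hfeas : A xs + B ys - b = 0 := by
    have h1 := h.1 (ls + (A xs + B ys - b))
    rw [lagrangian, lagrangian, ha, hc, inner_add_left] at h1
    norm_cast at h1
    rw [real_inner_self_eq_norm_sq] at h1
    have : ‖A xs + B ys - b‖ ^ 2 = 0 := le_antisymm (by linarith) (sq_nonneg _)
    simpa using this
  refine ⟨a + c, by rw [ha, hc]; norm_cast, sub_eq_zero.1 hfeas, fun x y => ?_⟩
  refine le_trans (le_of_eq ?_) (h.2 x y)
  rw [lagrangian, ha, hc, hfeas, inner_zero_right]
  norm_cast
  rw [add_zero]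

variable (f g A B b) in
/-- The points whose Lagrangian value at the multiplier `ls` exceeds `v` by at most `τ`, and whose
constraint violation is at most `τ`. At a saddle value `v` and `τ = 0` these are the solutions. -/
def nearOptimalSet (ls : Z) (v τ : ℝ) : Set (WithLp 2 (X × Y)) :=
  {u | lagrangian f g A B b u.fst u.snd ls ≤ ((v + τ : ℝ) : EReal) ∧
    ‖A u.fst + B u.snd - b‖ ≤ τ}

theorem isClosed_nearOptimalSet (hf : IsProperConvexLsc f) (hg : IsProperConvexLsc g)
    (ls : Z) (v τ : ℝ) : IsClosed (nearOptimalSet f g A B b ls v τ) := by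
  have h1 : Continuous fun u : WithLp 2 (X × Y) => u.fst := by fun_prop
  have h2 : Continuous fun u : WithLp 2 (X × Y) => u.snd := by fun_prop
  have hr : Continuous fun u : WithLp 2 (X × Y) => A u.fst + B u.snd - b := by fun_prop
  refine IsClosed.inter ?_ (isClosed_le hr.norm continuous_const)
  have hsum : LowerSemicontinuous fun u : WithLp 2 (X × Y) => f u.fst + g u.snd :=
    (hf.lsc.comp h1).add' (hg.lsc.comp h2) fun u =>
      EReal.continuousAt_add (.inr (hg.ne_bot _)) (.inl (hf.ne_bot _))
  have hin : Continuous fun u : WithLp 2 (X × Y) =>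
      ((inner ℝ ls (A u.fst + B u.snd - b) : ℝ) : EReal) :=
    continuous_coe_real_ereal.comp (continuous_const.inner hr)
  have hL := hsum.add' hin.lowerSemicontinuous fun u =>
    EReal.continuousAt_add (.inr (EReal.coe_ne_bot _)) (.inr (EReal.coe_ne_top _))
  exact hL.isClosed_preimage _

theorem convex_nearOptimalSet (hf : IsProperConvexLsc f) (hg : IsProperConvexLsc g)
    (ls : Z) (v τ : ℝ) : Convex ℝ (nearOptimalSet f g A B b ls v τ) := by
  rintro u ⟨hu1, hu2⟩ w ⟨hw1, hw2⟩ s t hs ht hst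
  obtain ⟨hfu, hgu⟩ :=
    ne_top_of_add_coe_ne_top hf hg (ne_top_of_le_ne_top (EReal.coe_ne_top _) hu1)
  obtain ⟨hfw, hgw⟩ :=
    ne_top_of_add_coe_ne_top hf hg (ne_top_of_le_ne_top (EReal.coe_ne_top _) hw1)
  obtain ⟨a, ha⟩ := hf.exists_coe hfu
  obtain ⟨c, hc⟩ := hg.exists_coe hgu
  obtain ⟨a', ha'⟩ := hf.exists_coe hfw
  obtain ⟨c', hc'⟩ := hg.exists_coe hgw
  have hres : A (s • u + t • w).fst + B (s • u + t • w).snd - b =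
      s • (A u.fst + B u.snd - b) + t • (A w.fst + B w.snd - b) := by
    have : b = s • b + t • b := by rw [← add_smul, hst, one_smul]
    conv_lhs => rw [this]
    simp only [WithLp.add_fst, WithLp.add_snd, WithLp.smul_fst, WithLp.smul_snd, map_add, map_smul]
    module
  constructor
  · rw [lagrangian, ha, hc] at hu1
    rw [lagrangian, ha', hc'] at hw1
    norm_cast at hu1 hw1
    have h1 := hf.le_combo ha.le ha'.le hs ht hst
    have h2 := hg.le_combo hc.le hc'.le hs ht hst
    have h3 := add_le_add_left (add_le_add h1 h2)
      ((inner ℝ ls (A (s • u + t • w).fst + B (s • u + t • w).snd - b) : ℝ) : EReal)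
    refine le_trans h3 ?_
    norm_cast
    rw [hres, inner_add_right, inner_smul_right, inner_smul_right]
    have k1 := mul_le_mul_of_nonneg_left hu1 hs
    have k2 := mul_le_mul_of_nonneg_left hw1 ht
    have k3 : v + τ = s * (v + τ) + t * (v + τ) := by rw [← add_mul, hst, one_mul]
    linarith
  · rw [hres]
    calc _ ≤ ‖s • (A u.fst + B u.snd - b)‖ + ‖t • (A w.fst + B w.snd - b)‖ := norm_add_le _ _
      _ = s * ‖A u.fst + B u.snd - b‖ + t * ‖A w.fst + B w.snd - b‖ := by
        rw [norm_smul, norm_smul, Real.norm_of_nonneg hs, Real.norm_of_nonneg ht]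
      _ ≤ s * τ + t * τ := by gcongr
      _ = τ := by rw [← add_mul, hst, one_mul]

theorem nearOptimalSet_mono (ls : Z) (v : ℝ) {τ τ' : ℝ} (h : τ ≤ τ') :
    nearOptimalSet f g A B b ls v τ ⊆ nearOptimalSet f g A B b ls v τ' := fun _ hu =>
  ⟨hu.1.trans (by exact_mod_cast (by linarith : v + τ ≤ v + τ')), hu.2.trans h⟩

theorem mem_nearOptimalSet_zero_iff {xs : X} {ys : Y} {ls : Z} {v : ℝ}
    (hv : f xs + g ys = v) (hfeas : A xs + B ys = b)
    (hlow : ∀ x y, (v : EReal) ≤ lagrangian f g A B b x y ls) {p : X × Y} :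
    WithLp.toLp 2 p ∈ nearOptimalSet f g A B b ls v 0 ↔ p ∈ solutionSet f g A B b := by
  have hlag : ∀ x y, A x + B y = b → lagrangian f g A B b x y ls = f x + g y := by
    intro x y h
    rw [lagrangian, h, sub_self, inner_zero_right, EReal.coe_zero, add_zero]
  constructor
  · rintro ⟨h1, h2⟩
    have h3 : A p.1 + B p.2 = b := sub_eq_zero.1 (norm_le_zero_iff.1 h2)
    refine ⟨h3, fun x y hxy => ?_⟩
    have h4 : f p.1 + g p.2 ≤ ((v + 0 : ℝ) : EReal) := (hlag _ _ h3).symm.le.trans h1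
    rw [add_zero] at h4
    exact h4.trans ((hlow x y).trans (hlag x y hxy).le)
  · rintro ⟨h1, h2⟩
    refine ⟨?_, ?_⟩
    · rw [add_zero, ← hv]
      exact (hlag _ _ h1).le.trans (h2 xs ys hfeas)
    · exact norm_le_zero_iff.2 (sub_eq_zero.2 h1)

theorem mem_nearOptimalSet_zero_of_forall {ls : Z} {v : ℝ} {u : WithLp 2 (X × Y)}
    (h : ∀ n : ℕ, u ∈ nearOptimalSet f g A B b ls v (1 / (n + 1))) :
    u ∈ nearOptimalSet f g A B b ls v 0 := by
  have hlim : Tendsto (fun n : ℕ => (1 : ℝ) / (n + 1)) atTop (𝓝 0) :=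
    tendsto_one_div_add_atTop_nhds_zero_nat
  constructor
  · refine ge_of_tendsto (x := atTop) ?_ (Eventually.of_forall fun n => (h n).1)
    exact (continuous_coe_real_ereal.tendsto _).comp (tendsto_const_nhds.add hlim)
  · exact ge_of_tendsto hlim (Eventually.of_forall fun n => (h n).2)

theorem existsUnique_isMinNormSolution [CompleteSpace X] [CompleteSpace Y]
    (hf : IsProperConvexLsc f) (hg : IsProperConvexLsc g)
    {xs : X} {ys : Y} {ls : Z} (h : IsSaddlePoint f g A B b xs ys ls) :
    ∃! p : X × Y, IsMinNormSolution f g A B b p := by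
  obtain ⟨v, hv, hfeas, hlow⟩ := h.exists_value hf hg
  have hiff := fun p : X × Y => mem_nearOptimalSet_zero_iff (p := p) hv hfeas hlow
  have hs : (xs, ys) ∈ solutionSet f g A B b :=
    ⟨hfeas, fun x y hxy => by
      have := hlow x y
      rw [lagrangian, hxy, sub_self, inner_zero_right, EReal.coe_zero, add_zero] at this
      exact hv.le.trans this⟩
  obtain ⟨q, hq, hproj⟩ := exists_norm_sub_sq_le ⟨_, (hiff _).2 hs⟩
    (isClosed_nearOptimalSet hf hg ls v 0) (convex_nearOptimalSet hf hg ls v 0)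
  refine ⟨q.ofLp, ⟨(hiff _).1 hq, fun z hz => ?_⟩, fun z hz => ?_⟩
  · have := hproj _ ((hiff z).2 hz)
    exact le_of_sq_le_sq (by linarith [sq_nonneg ‖WithLp.toLp 2 z - q‖]) (norm_nonneg _)
  · have h1 := hproj _ ((hiff z).2 hz.1)
    have h2 : ‖WithLp.toLp 2 z‖ ^ 2 ≤ ‖q‖ ^ 2 := by
      have := hz.2 q.ofLp ((hiff _).1 hq)
      gcongr
    have h3 : ‖WithLp.toLp 2 z - q‖ ^ 2 = 0 := le_antisymm (by linarith) (sq_nonneg _)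
    have h4 : WithLp.toLp 2 z = q := by simpa [sub_eq_zero] using h3
    rw [← h4]

/-! ### One step of the algorithm -/

section Algorithm
variable {μf μg δ γ : ℝ} {α β ε : ℕ → ℝ} {x : ℕ → X} {y : ℕ → Y} {l : ℕ → Z}
  {Zs : ℕ → X} {Hs : ℕ → Y} {Zd : ℕ → X} {Hd : ℕ → Y}

/-- The optimality conditions of one step, in the form of an implicit scheme: the multiplier in
them is exactly the updated multiplier `l (k + 1)`. -/
theorem IsJointAlgorithm.optimality [CompleteSpace X] [CompleteSpace Y] [CompleteSpace Z]
    (h : IsJointAlgorithm f g A B b μf μg δ γ α β ε x y l Zs Hs Zd Hd)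
    (hf : IsProperConvexLsc f) (hg : IsProperConvexLsc g) (hμf : 0 ≤ μf) (hμg : 0 ≤ μg)
    (hδ : 0 < δ) (hγ : 0 < γ) {k : ℕ} (hk : 1 ≤ k) (hα : 0 < α k) (hβ : 0 < β k) :
    f (x (k + 1)) ≠ ⊤ ∧ g (y (k + 1)) ≠ ⊤ ∧
    (∃ ξ ∈ subdifferential f (x (k + 1)), Zs (k + 1) - Zs k =
      -((μf * δ * β k) • (x (k + 1) - x k)) -
        (α k * β k) • (ξ + A.adjoint (l (k + 1)) + ε k • x (k + 1))) ∧
    (∃ ξ ∈ subdifferential g (y (k + 1)), Hs (k + 1) - Hs k =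
      -((μg * δ * β k) • (y (k + 1) - y k)) -
        (α k * β k) • (ξ + B.adjoint (l (k + 1)) + ε k • y (k + 1))) ∧
    Zd (k + 1) = x (k + 1) + (δ / α k) • (x (k + 1) - x k) ∧
    Hd (k + 1) = y (k + 1) + (δ / α k) • (y (k + 1) - y k) := by
  have hZd : Zd (k + 1) = x (k + 1) + (δ / α k) • (x (k + 1) - x k) := by
    rw [h.step_Zd k hk, h.step_Z k hk]; module
  have hHd : Hd (k + 1) = y (k + 1) + (δ / α k) • (y (k + 1) - y k) := by
    rw [h.step_Hd k hk, h.step_H k hk]; module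
  have hη : ∀ μ : ℝ, 0 ≤ μ → γ + 1 / α k + μ * δ * β k ≠ 0 := fun μ hμ => by positivity
  obtain ⟨ηf, hηf⟩ : ∃ η, η = γ + 1 / α k + μf * δ * β k := ⟨_, rfl⟩
  obtain ⟨ηg, hηg⟩ : ∃ η, η = γ + 1 / α k + μg * δ * β k := ⟨_, rfl⟩
  have hηf0 : ηf ≠ 0 := hηf ▸ hη μf hμf
  have hηg0 : ηg ≠ 0 := hηg ▸ hη μg hμg
  set l' : Z := l k - (δ * β k) • (A (x k) + B (y k) - b) with hl'
  set x' : X := x k + (1 / ηf) • (Zs k - γ • x k) with hx'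
  set y' : Y := y k + (1 / ηg) • (Hs k - γ • y k) with hy'
  set θ : ℝ := (α k + δ) * β k with hθ
  have hobj : ∀ p : X × Y, stepObjective f g A B b μf μg δ γ (α k) (β k) (ε k) (x k) (y k) (l k)
      (Zs k) (Hs k) p = f p.1 + g p.2 + ((inner ℝ l' (A p.1 + B p.2 - b)
        + θ / 2 * ‖A p.1 + B p.2 - b‖ ^ 2 + (ηf / (2 * α k * β k) * ‖p.1 - x'‖ ^ 2
        + ηg / (2 * α k * β k) * ‖p.2 - y'‖ ^ 2
        + ε k / 2 * ‖p.1‖ ^ 2 + ε k / 2 * ‖p.2‖ ^ 2) : ℝ) : EReal) := by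
    intro p
    simp only [stepObjective, augLagrangian, lagrangian, EReal.coe_add, add_assoc, hl', hx', hy',
      hθ, hηf, hηg]
  have hmin := fun p : X × Y => isMinOn_iff.1 (h.argmin k hk) p (Set.mem_univ p)
  simp only [hobj] at hmin
  obtain ⟨x0, hx0⟩ := hf.exists_ne_top
  obtain ⟨y0, hy0⟩ := hg.exists_ne_top
  obtain ⟨a0, ha0⟩ := hf.exists_coe hx0
  obtain ⟨c0, hc0⟩ := hg.exists_coe hy0
  obtain ⟨hx1, hy1⟩ := ne_top_of_add_coe_ne_top hf hg (ne_top_of_le_ne_top (by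
    simp only [ha0, hc0]
    exact_mod_cast EReal.coe_ne_top _) (hmin (x0, y0)))
  obtain ⟨a1, ha1⟩ := hf.exists_coe hx1
  obtain ⟨c1, hc1⟩ := hg.exists_coe hy1
  have hl1 : l' + θ • (A (x (k + 1)) + B (y (k + 1)) - b) = l (k + 1) := by
    rw [h.step_l k hk, hZd, hHd, hl', hθ]
    simp only [map_add, map_sub, map_smul]
    have : α k * β k * (δ / α k) = δ * β k := by field_simp
    have e : (α k * β k) • (A (x (k + 1)) + (δ / α k) • (A (x (k + 1)) - A (x k)) +
        (B (y (k + 1)) + (δ / α k) • (B (y (k + 1)) - B (y k))) - b) =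
        (α k * β k) • (A (x (k + 1)) + B (y (k + 1)) - b) + (α k * β k * (δ / α k)) •
          (A (x (k + 1)) - A (x k) + B (y (k + 1)) - B (y k)) := by module
    rw [e, this]
    module
  refine ⟨hx1, hy1, ⟨_, mem_subdifferential_of_block_min hf hx1 A (B (y (k + 1)) - b) l' θ
    (ηf / (α k * β k)) (ε k) (x' := x') fun z => ?_, ?_⟩, ⟨_, mem_subdifferential_of_block_min
    hg hy1 B (A (x (k + 1)) - b) l' θ (ηg / (α k * β k)) (ε k) (x' := y') fun z => ?_, ?_⟩,
    hZd, hHd⟩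
  · by_cases hz : f z = ⊤
    · rw [hz, EReal.top_add_coe]; exact le_top
    obtain ⟨a, ha⟩ := hf.exists_coe hz
    have := hmin (z, y (k + 1))
    simp only [ha, ha1, hc1] at this ⊢
    norm_cast at this ⊢
    simp only [add_sub_assoc] at this
    have e : ηf / (α k * β k) / 2 = ηf / (2 * α k * β k) := by field_simp
    rw [e]
    linarith
  · have e1 : l' + θ • (A (x (k + 1)) + (B (y (k + 1)) - b)) = l (k + 1) := by
      rw [← hl1, add_sub_assoc]
    rw [e1]
    have e2 : (α k * β k) • (ηf / (α k * β k)) • (x (k + 1) - x') =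
        Zs (k + 1) - Zs k + (μf * δ * β k) • (x (k + 1) - x k) := by
      rw [smul_smul, mul_div_cancel₀ _ (by positivity), hx', ← sub_sub, smul_sub, smul_smul,
        mul_one_div_cancel hηf0, one_smul, hηf, h.step_Z k hk]
      module
    have e3 : (α k * β k) • (-(A.adjoint (l (k + 1)) + (ηf / (α k * β k)) • (x (k + 1) - x') +
        ε k • x (k + 1)) + A.adjoint (l (k + 1)) + ε k • x (k + 1)) =
        -((α k * β k) • (ηf / (α k * β k)) • (x (k + 1) - x')) := by
      rw [← smul_neg]; congr 1; abel
    rw [e3, e2]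
    abel
  · by_cases hz : g z = ⊤
    · rw [hz, EReal.top_add_coe]; exact le_top
    obtain ⟨c, hc⟩ := hg.exists_coe hz
    have := hmin (x (k + 1), z)
    simp only [hc, ha1, hc1] at this ⊢
    norm_cast at this ⊢
    simp only [add_comm (A _), add_sub_assoc] at this
    have e : ηg / (α k * β k) / 2 = ηg / (2 * α k * β k) := by field_simp
    rw [e]
    linarith
  · have e1 : l' + θ • (B (y (k + 1)) + (A (x (k + 1)) - b)) = l (k + 1) := by
      rw [← hl1, ← add_sub_assoc, add_comm (B _)]
    rw [e1]
    have e2 : (α k * β k) • (ηg / (α k * β k)) • (y (k + 1) - y') =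
        Hs (k + 1) - Hs k + (μg * δ * β k) • (y (k + 1) - y k) := by
      rw [smul_smul, mul_div_cancel₀ _ (by positivity), hy', ← sub_sub, smul_sub, smul_smul,
        mul_one_div_cancel hηg0, one_smul, hηg, h.step_H k hk]
      module
    have e3 : (α k * β k) • (-(B.adjoint (l (k + 1)) + (ηg / (α k * β k)) • (y (k + 1) - y') +
        ε k • y (k + 1)) + B.adjoint (l (k + 1)) + ε k • y (k + 1)) =
        -((α k * β k) • (ηg / (α k * β k)) • (y (k + 1) - y')) := by
      rw [← smul_neg]; congr 1; abel
    rw [e3, e2]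
    abel

/-- The energy estimate. Here `W k` is the part of the energy made of squared distances to the
solution `p` and the multiplier `ls`, and `φ k` is the Lagrangian gap at the `k`-th iterate. The
index starts at `2` because the initial point need not lie in the domain of `f` and `g`. -/
theorem IsJointAlgorithm.exists_energy [CompleteSpace X] [CompleteSpace Y] [CompleteSpace Z]
    (h : IsJointAlgorithm f g A B b μf μg δ γ α β ε x y l Zs Hs Zd Hd)
    (hf : InClassS μf f) (hg : InClassS μg g) (hμf : 0 ≤ μf) (hμg : 0 ≤ μg)
    (hδ : 0 < δ) (hγ : 0 < γ) (hδγ : 0 ≤ δ * γ - 1)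
    (hαpos : ∀ k, 1 ≤ k → 0 < α k) (hβpos : ∀ k, 1 ≤ k → 0 < β k)
    (hεpos : ∀ k, 1 ≤ k → 0 < ε k)
    (hαβ : ∀ k, 1 ≤ k → δ * β (k + 1) ≤ δ * β k + α k * β k)
    {ls : Z} {v : ℝ} (hlow : ∀ x y, (v : EReal) ≤ lagrangian f g A B b x y ls)
    {p : X × Y} (hp : f p.1 + g p.2 = v) (hfeas : A p.1 + B p.2 = b) :
    ∃ W φ : ℕ → ℝ, ∀ k, 2 ≤ k → δ / 2 * ‖l k - ls‖ ^ 2 ≤ W k ∧ 0 ≤ φ k ∧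
      lagrangian f g A B b (x k) (y k) ls = ((v + φ k : ℝ) : EReal) ∧
      W (k + 1) - W k ≤
        -(δ * α k * β k) * (φ (k + 1) + ε k / 2 * ((‖x (k + 1)‖ ^ 2 + ‖y (k + 1)‖ ^ 2)
          - (‖p.1‖ ^ 2 + ‖p.2‖ ^ 2)))
        - δ ^ 2 * β k * (φ (k + 1) - φ k + ε k / 2 * ((‖x (k + 1)‖ ^ 2 + ‖y (k + 1)‖ ^ 2)
          - (‖x k‖ ^ 2 + ‖y k‖ ^ 2))) := by
  have hf' := hf.toIsProperConvexLsc
  have hg' := hg.toIsProperConvexLsc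
  have hpc : f p.1 + g p.2 + ((0 : ℝ) : EReal) ≠ ⊤ := by
    rw [hp]; exact_mod_cast EReal.coe_ne_top _
  obtain ⟨hp1, hp2⟩ := ne_top_of_add_coe_ne_top hf' hg' hpc
  obtain ⟨a, ha⟩ := hf'.exists_coe hp1
  obtain ⟨c, hc⟩ := hg'.exists_coe hp2
  have hv : a + c = v := by rw [ha, hc] at hp; exact_mod_cast hp
  have hfin : ∀ k, 2 ≤ k → ∃ s t : ℝ, f (x k) = s ∧ g (y k) = t := by
    intro k hk
    obtain ⟨j, rfl⟩ : ∃ j, k = j + 1 := ⟨k - 1, by omega⟩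
    obtain ⟨h1, h2, -⟩ := h.optimality hf' hg' hμf hμg hδ hγ (k := j) (by omega)
      (hαpos j (by omega)) (hβpos j (by omega))
    obtain ⟨s, hs⟩ := hf'.exists_coe h1
    obtain ⟨t, ht⟩ := hg'.exists_coe h2
    exact ⟨s, t, hs, ht⟩
  choose! F G hFG using hfin
  refine ⟨fun k => (1 / 2 * ‖Zd k - p.1‖ ^ 2
      + (δ * γ - 1 + δ ^ 2 * β k * μf) / 2 * ‖x k - p.1‖ ^ 2)
    + (1 / 2 * ‖Hd k - p.2‖ ^ 2 + (δ * γ - 1 + δ ^ 2 * β k * μg) / 2 * ‖y k - p.2‖ ^ 2)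
    + δ / 2 * ‖l k - ls‖ ^ 2,
    fun k => F k + G k + inner ℝ ls (A (x k) + B (y k) - b) - v, fun k hk => ?_⟩
  have hlag : lagrangian f g A B b (x k) (y k) ls =
      ((F k + G k + inner ℝ ls (A (x k) + B (y k) - b) : ℝ) : EReal) := by
    rw [lagrangian, (hFG k hk).1, (hFG k hk).2]; norm_cast
  have hα := hαpos k (by omega)
  have hβ := hβpos k (by omega)
  refine ⟨?_, ?_, by rw [hlag]; congr 1; ring, ?_⟩
  · have : 0 ≤ (1 / 2 * ‖Zd k - p.1‖ ^ 2
        + (δ * γ - 1 + δ ^ 2 * β k * μf) / 2 * ‖x k - p.1‖ ^ 2)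
      + (1 / 2 * ‖Hd k - p.2‖ ^ 2 + (δ * γ - 1 + δ ^ 2 * β k * μg) / 2 * ‖y k - p.2‖ ^ 2) := by
      positivity
    simp only
    linarith
  · have := hlow (x k) (y k)
    rw [hlag] at this
    norm_cast at this
    simp only
    linarith
  obtain ⟨-, -, ⟨ξ, hξ, hZ⟩, ⟨ζ, hζ, hH⟩, hZd, hHd⟩ := h.optimality hf' hg' hμf hμg hδ hγ
    (k := k) (by omega) hα hβ
  obtain ⟨j, rfl⟩ : ∃ j, k = j + 1 := ⟨k - 1, by omega⟩
  obtain ⟨hF0, hG0⟩ := hFG (j + 1) hk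
  obtain ⟨hF1, hG1⟩ := hFG (j + 1 + 1) (by omega)
  have sf : ∀ z : X, ∀ s : ℝ, f z = s → F (j + 1 + 1) + (inner ℝ ξ (z - x (j + 1 + 1))
      + μf / 2 * ‖z - x (j + 1 + 1)‖ ^ 2) ≤ s := fun z s hs => by
    have := hf.strong z _ ξ hξ
    rw [hs, hF1] at this
    exact_mod_cast this
  have sg : ∀ z : Y, ∀ s : ℝ, g z = s → G (j + 1 + 1) + (inner ℝ ζ (z - y (j + 1 + 1))
      + μg / 2 * ‖z - y (j + 1 + 1)‖ ^ 2) ≤ s := fun z s hs => by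
    have := hg.strong z _ ζ hζ
    rw [hs, hG1] at this
    exact_mod_cast this
  have hε := (hεpos (j + 1) (by omega)).le
  have bx := block_energy_step hμf hδ hδγ hα hβ hε (hαβ (j + 1) (by omega)) hZ
    (h.step_Zd j (by omega)) (h.step_Zd (j + 1) (by omega)) hZd (sf _ _ ha) (sf _ _ hF0)
  have bY := block_energy_step hμg hδ hδγ hα hβ hε (hαβ (j + 1) (by omega)) hH
    (h.step_Hd j (by omega)) (h.step_Hd (j + 1) (by omega)) hHd (sg _ _ hc) (sg _ _ hG0)
  obtain ⟨R, hR⟩ : ∃ R, R = A (Zd (j + 1 + 1)) + B (Hd (j + 1 + 1)) - b := ⟨_, rfl⟩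
  have hadj : inner ℝ (A.adjoint (l (j + 1 + 1))) (Zd (j + 1 + 1) - p.1) +
      inner ℝ (B.adjoint (l (j + 1 + 1))) (Hd (j + 1 + 1) - p.2) = inner ℝ (l (j + 1 + 1)) R := by
    rw [ContinuousLinearMap.adjoint_inner_left, ContinuousLinearMap.adjoint_inner_left,
      ← inner_add_right, hR, ← hfeas, map_sub, map_sub]
    congr 1; abel
  have hdual : ‖l (j + 1) - ls‖ ^ 2 = ‖l (j + 1 + 1) - ls‖ ^ 2
      - 2 * (α (j + 1) * β (j + 1) * (inner ℝ (l (j + 1 + 1)) R - inner ℝ ls R))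
      + ‖l (j + 1 + 1) - l (j + 1)‖ ^ 2 := by
    have e1 : l (j + 1) - ls = (l (j + 1 + 1) - ls) - (l (j + 1 + 1) - l (j + 1)) := by abel
    have e2 : l (j + 1 + 1) - l (j + 1) = (α (j + 1) * β (j + 1)) • R := by
      rw [h.step_l (j + 1) (by omega), hR]; abel
    rw [e1, norm_sub_sq_real]
    congr 2
    rw [e2, inner_smul_right, inner_sub_left]
  have hlsR : α (j + 1) * inner ℝ ls R = α (j + 1) *
      inner ℝ ls (A (x (j + 1 + 1)) + B (y (j + 1 + 1)) - b) +
      δ * (inner ℝ ls (A (x (j + 1 + 1)) + B (y (j + 1 + 1)) - b) -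
        inner ℝ ls (A (x (j + 1)) + B (y (j + 1)) - b)) := by
    have e : R = (A (x (j + 1 + 1)) + B (y (j + 1 + 1)) - b) + (δ / α (j + 1)) •
        ((A (x (j + 1 + 1)) + B (y (j + 1 + 1)) - b) - (A (x (j + 1)) + B (y (j + 1)) - b)) := by
      rw [hR, hZd, hHd]
      simp only [map_add, map_sub, map_smul]
      module
    rw [e, inner_add_right, inner_smul_right, inner_sub_right _ (_ - b)]
    field_simp
  have m1 := congrArg (δ * α (j + 1) * β (j + 1) * ·) hadj
  have m2 := congrArg (δ / 2 * ·) hdual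
  have m3 := congrArg (δ * β (j + 1) * ·) hlsR
  have m4 : 0 ≤ δ / 2 * ‖l (j + 1 + 1) - l (j + 1)‖ ^ 2 := by positivity
  simp only at m1 m2 m3 ⊢
  rw [← hv]
  linarith

end Algorithm
end Product

/-! ### Asymptotics of the iterates -/

/-- The scalar form of the energy estimate, with the regularization measured from a level `s` that
does not exceed `N'`. The level `s = 0` gives nonnegative energies with a source term; the level
`s = Ns` gives energies that do not increase as long as `Ns ≤ N'`. -/
theorem energy_step_of_level {W W' φ φ' N N' Ns s α β β' δ ε ε' : ℝ} (hδ : 0 < δ)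
    (hβ' : δ * β' ≤ δ * β + α * β) (hα : 0 < α) (hβ : 0 < β) (hε' : 0 ≤ ε') (hε : ε' ≤ ε)
    (hφ' : 0 ≤ φ') (hs : s ≤ N')
    (h : W' - W ≤ -(δ * α * β) * (φ' + ε / 2 * (N' - Ns))
      - δ ^ 2 * β * (φ' - φ + ε / 2 * (N' - N))) :
    W' + δ ^ 2 * β' * (φ' + ε' / 2 * (N' - s)) ≤
      W + δ ^ 2 * β * (φ + ε / 2 * (N - s)) + β * (δ * (Ns - s) / 2 * (α * ε)) := by
  have hs' := sub_nonneg.2 hs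
  have h1 := mul_le_mul_of_nonneg_left hβ'
    (show 0 ≤ δ * (φ' + ε' / 2 * (N' - s)) by positivity)
  have h2 := mul_le_mul_of_nonneg_left hε
    (show 0 ≤ δ * (δ * β + α * β) / 2 * (N' - s) by positivity)
  linarith

section Algorithm
variable {X Y Z : Type*}
  [NormedAddCommGroup X] [InnerProductSpace ℝ X] [NormedAddCommGroup Y] [InnerProductSpace ℝ Y]
  [NormedAddCommGroup Z] [InnerProductSpace ℝ Z]
  {f : X → EReal} {g : Y → EReal} {A : X →L[ℝ] Z} {B : Y →L[ℝ] Z} {b : Z}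
  {μf μg δ γ : ℝ} {α β ε : ℕ → ℝ} {x : ℕ → X} {y : ℕ → Y} {l : ℕ → Z}
  {Zs : ℕ → X} {Hs : ℕ → Y} {Zd : ℕ → X} {Hd : ℕ → Y}

theorem pos_of_tendsto_mul_atTop (hβpos : ∀ k, 1 ≤ k → 0 < β k)
    (hεanti : ∀ k, 1 ≤ k → ε (k + 1) ≤ ε k)
    (hβε : Tendsto (fun k => β k * ε k) atTop atTop) : ∀ k, 1 ≤ k → 0 < ε k := by
  intro k hk
  have hle : ∀ n, k ≤ n → ε n ≤ ε k := fun n hn => by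
    induction n, hn using Nat.le_induction with
    | base => exact le_rfl
    | succ n hn ih => exact (hεanti n (by omega)).trans ih
  obtain ⟨n, hn1, hn2⟩ := ((hβε.eventually_gt_atTop 0).and (eventually_ge_atTop k)).exists
  exact (pos_of_mul_pos_right hn1 (hβpos n (by omega)).le).trans_le (hle n hn2)

/-- The Lagrangian gap and the constraint violation tend to zero; and if the iterates eventually
have norm at least that of the solution `p`, their norms are asymptotically at most that of `p`. -/
theorem IsJointAlgorithm.asymptotics [CompleteSpace X] [CompleteSpace Y] [CompleteSpace Z]
    (h : IsJointAlgorithm f g A B b μf μg δ γ α β ε x y l Zs Hs Zd Hd)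
    (hf : InClassS μf f) (hg : InClassS μg g) (hμf : 0 ≤ μf) (hμg : 0 ≤ μg)
    (hδ : 0 < δ) (hγ : 0 < γ) (hδγ : 0 ≤ δ * γ - 1)
    (hβpos : ∀ k, 1 ≤ k → 0 < β k) (hβmono : ∀ k, 1 ≤ k → β k ≤ β (k + 1))
    (hβlim : Tendsto β atTop atTop) (hαpos : ∀ k, 1 ≤ k → 0 < α k)
    (hαβ : ∀ k, 1 ≤ k → δ * β (k + 1) ≤ δ * β k + α k * β k)
    (hεanti : ∀ k, 1 ≤ k → ε (k + 1) ≤ ε k)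
    (hαε : Summable (fun k : ℕ => α (k + 1) * ε (k + 1)))
    (hβε : Tendsto (fun k => β k * ε k) atTop atTop)
    {ls : Z} {v : ℝ} (hlow : ∀ x y, (v : EReal) ≤ lagrangian f g A B b x y ls)
    {p : X × Y} (hp : f p.1 + g p.2 = v) (hfeas : A p.1 + B p.2 = b) :
    (∀ τ > 0, ∀ᶠ k in atTop,
      WithLp.toLp 2 (x k, y k) ∈ nearOptimalSet f g A B b ls v τ) ∧
    ((∀ᶠ k in atTop, ‖p.1‖ ^ 2 + ‖p.2‖ ^ 2 ≤ ‖x k‖ ^ 2 + ‖y k‖ ^ 2) →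
      ∀ η > 0, ∀ᶠ k in atTop, ‖x k‖ ^ 2 + ‖y k‖ ^ 2 ≤ ‖p.1‖ ^ 2 + ‖p.2‖ ^ 2 + η) := by
  have hεpos := pos_of_tendsto_mul_atTop hβpos hεanti hβε
  obtain ⟨W, φ, hW⟩ := h.exists_energy hf hg hμf hμg hδ hγ hδγ hαpos hβpos hεpos hαβ hlow hp hfeas
  obtain ⟨N, hN⟩ : ∃ N : ℕ → ℝ, ∀ k, N k = ‖x k‖ ^ 2 + ‖y k‖ ^ 2 := ⟨_, fun _ => rfl⟩
  obtain ⟨Ns, hNs⟩ : ∃ Ns : ℝ, Ns = ‖p.1‖ ^ 2 + ‖p.2‖ ^ 2 := ⟨_, rfl⟩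
  simp only [← hN, ← hNs] at hW ⊢
  have hN0 : ∀ k, 0 ≤ N k := fun k => by rw [hN]; positivity
  have hNs0 : 0 ≤ Ns := by rw [hNs]; positivity
  have hW0 : ∀ k, 2 ≤ k → 0 ≤ W k := fun k hk => le_trans (by positivity) (hW k hk).1
  have hstep : ∀ s, ∀ k, 2 ≤ k → s ≤ N (k + 1) →
      W (k + 1) + δ ^ 2 * β (k + 1) * (φ (k + 1) + ε (k + 1) / 2 * (N (k + 1) - s)) ≤
      W k + δ ^ 2 * β k * (φ k + ε k / 2 * (N k - s))
        + β k * (δ * (Ns - s) / 2 * (α k * ε k)) := fun s k hk hs =>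
    energy_step_of_level hδ (hαβ k (by omega)) (hαpos k (by omega)) (hβpos k (by omega))
      (hεpos (k + 1) (by omega)).le (hεanti k (by omega)) (hW (k + 1) (by omega)).2.1 hs
      (hW k hk).2.2.2
  constructor
  · have hreg : ∀ k, 2 ≤ k → 0 ≤ ε k / 2 * (N k - 0) := fun k hk => by
      have := (hεpos k (by omega)).le
      have := hN0 k
      rw [sub_zero]; positivity
    obtain ⟨E, hE⟩ : ∃ E : ℕ → ℝ, ∀ k, E k = W k + δ ^ 2 * β k * (φ k + ε k / 2 * (N k - 0)) :=
      ⟨_, fun _ => rfl⟩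
    have hlim := tendsto_div_zero_of_le_add (E := E)
      (c := fun k => δ * (Ns - 0) / 2 * (α k * ε k))
      (fun k hk => by
        have h1 := hW0 k hk
        have h2 := (hW k hk).2.1
        have h3 := hβpos k (by omega)
        have h4 := hreg k hk
        rw [hE]; positivity) hβpos hβmono hβlim
      (fun k hk => by
        have := hαpos k hk
        have := hεpos k hk
        rw [sub_zero]; positivity)
      (hαε.mul_left (δ * (Ns - 0) / 2)) (fun k hk => by rw [hE, hE]; exact hstep 0 k hk (hN0 _))
    have hφ : Tendsto φ atTop (𝓝 0) := by
      have hlim' := hlim.const_mul (δ ^ 2)⁻¹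
      rw [mul_zero] at hlim'
      refine squeeze_zero' ((eventually_ge_atTop 2).mono fun k hk => (hW k hk).2.1) ?_ hlim'
      filter_upwards [eventually_ge_atTop 2] with k hk
      have h3 := hβpos k (by omega)
      rw [inv_mul_eq_div, div_div, le_div_iff₀ (by positivity), hE]
      have h4 := mul_nonneg (show 0 ≤ δ ^ 2 * β k by positivity) (hreg k hk)
      linarith [hW0 k hk]
    obtain ⟨C, hC⟩ := hlim.bddAbove_range
    have hr : Tendsto (fun k => A (x k) + B (y k) - b) atTop (𝓝 0) := by
      refine tendsto_residual_zero (m := fun k => l k - ls) (M := 2 / δ * C) hδ hβpos hβmono hβlim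
        hαpos hαβ (fun k hk => ?_) (fun k hk => ?_)
      · have hα := hαpos k (by omega)
        obtain ⟨-, -, -, -, hZd, hHd⟩ := h.optimality hf.toIsProperConvexLsc
          hg.toIsProperConvexLsc hμf hμg hδ hγ (k := k) (by omega) hα (hβpos k (by omega))
        have e : δ * β k = α k * β k * (δ / α k) := by field_simp
        rw [add_mul, e, h.step_l k (by omega), hZd, hHd]
        simp only [map_add, map_sub, map_smul]
        module
      · have h1 := hC ⟨k, rfl⟩
        have hβ := hβpos k (by omega)
        simp only at h1
        rw [div_le_iff₀ hβ, hE] at h1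
        have h2 : 0 ≤ δ ^ 2 * β k * (φ k + ε k / 2 * (N k - 0)) :=
          mul_nonneg (by positivity) (add_nonneg (hW k hk).2.1 (hreg k hk))
        have h3 : δ / 2 * ‖l k - ls‖ ^ 2 ≤ C * β k := by linarith [(hW k hk).1]
        calc ‖l k - ls‖ ^ 2 = 2 / δ * (δ / 2 * ‖l k - ls‖ ^ 2) := by field_simp
          _ ≤ 2 / δ * (C * β k) := by gcongr
          _ = _ := by ring
    intro τ hτ
    filter_upwards [hφ.eventually_le_const hτ,
      (tendsto_zero_iff_norm_tendsto_zero.1 hr).eventually_le_const hτ, eventually_ge_atTop 2]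
      with k h1 h2 hk
    refine ⟨?_, h2⟩
    refine (hW k hk).2.2.1.le.trans ?_
    exact_mod_cast (by linarith : v + φ k ≤ v + τ)
  · intro hout η hη
    obtain ⟨K, hK⟩ := eventually_atTop.1 hout
    set K' := max K 2
    have hK2 : 2 ≤ K' := le_max_right _ _
    set C := W K' + δ ^ 2 * β K' * (φ K' + ε K' / 2 * (N K' - Ns)) with hCdef
    have hle : ∀ k, K' ≤ k → W k + δ ^ 2 * β k * (φ k + ε k / 2 * (N k - Ns)) ≤ C := by
      intro k hk
      induction k, hk using Nat.le_induction with
      | base => exact le_rfl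
      | succ k hk ih =>
        have h1 := hstep Ns k (by omega) (hK (k + 1) (by have := le_max_left K 2; omega))
        rw [sub_self, mul_zero, zero_div, zero_mul, mul_zero, add_zero] at h1
        exact h1.trans ih
    filter_upwards [eventually_ge_atTop K', hβε.eventually_gt_atTop (2 * C / (δ ^ 2 * η)),
      hβε.eventually_gt_atTop 0] with k hk h1 h0
    by_contra! hcon
    rw [div_lt_iff₀ (by positivity)] at h1
    have h2 := hle k hk
    have h3 := hW0 k (by omega)
    have h4 := mul_nonneg (show 0 ≤ δ ^ 2 * β k by have := hβpos k (by omega); positivity)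
      (hW k (by omega)).2.1
    have h5 := mul_le_mul_of_nonneg_left (show η ≤ N k - Ns by linarith)
      (show 0 ≤ δ ^ 2 / 2 * (β k * ε k) by positivity)
    linarith

end Algorithm

end PrimalDualJoint

theorem theorem4p1 {X Y Z : Type*}
    [NormedAddCommGroup X] [InnerProductSpace ℝ X] [CompleteSpace X]
    [NormedAddCommGroup Y] [InnerProductSpace ℝ Y] [CompleteSpace Y]
    [NormedAddCommGroup Z] [InnerProductSpace ℝ Z] [CompleteSpace Z]
    (f : X → EReal) (g : Y → EReal) (A : X →L[ℝ] Z) (B : Y →L[ℝ] Z) (b : Z)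
    (μf μg δ γ : ℝ) (α β ε : ℕ → ℝ)
    (x : ℕ → X) (y : ℕ → Y) (l : ℕ → Z)
    (Zs : ℕ → X) (Hs : ℕ → Y) (Zd : ℕ → X) (Hd : ℕ → Y)
    (xs : X) (ys : Y) (ls : Z)
    (hμf : 0 ≤ μf) (hμg : 0 ≤ μg)
    (hf : PrimalDualJoint.InClassS μf f) (hg : PrimalDualJoint.InClassS μg g)
    (hδ : 0 < δ) (hγ : 0 < γ) (hδγ : 0 ≤ δ * γ - 1)
    (hβpos : ∀ k, 1 ≤ k → 0 < β k) (hβmono : ∀ k, 1 ≤ k → β k ≤ β (k + 1))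
    (hβlim : Tendsto β atTop atTop)
    (hαpos : ∀ k, 1 ≤ k → 0 < α k)
    (hαβ : ∀ k, 1 ≤ k → δ * β (k + 1) ≤ δ * β k + α k * β k)
    (hεanti : ∀ k, 1 ≤ k → ε (k + 1) ≤ ε k)
    (hαε : Summable (fun k : ℕ => α (k + 1) * ε (k + 1)))
    (hβε : Tendsto (fun k => β k * ε k) atTop atTop)
    (hsaddle : PrimalDualJoint.IsSaddlePoint f g A B b xs ys ls)
    (halg : PrimalDualJoint.IsJointAlgorithm f g A B b μf μg δ γ α β ε x y l Zs Hs Zd Hd) :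
    (∃! p : X × Y, PrimalDualJoint.IsMinNormSolution f g A B b p) ∧
    ∀ p : X × Y, PrimalDualJoint.IsMinNormSolution f g A B b p →
      liminf (fun k => ‖WithLp.toLp 2 (x k, y k) - WithLp.toLp 2 p‖ₑ) atTop = 0 ∧
      (((∃ K : ℕ, 1 ≤ K ∧ ∀ k, K ≤ k →
            WithLp.toLp 2 (x k, y k) ∈ Metric.ball (0 : WithLp 2 (X × Y)) ‖WithLp.toLp 2 p‖) ∨
        (∃ K : ℕ, 1 ≤ K ∧ ∀ k, K ≤ k →
            WithLp.toLp 2 (x k, y k) ∉ Metric.ball (0 : WithLp 2 (X × Y)) ‖WithLp.toLp 2 p‖)) →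
        Tendsto (fun k => ‖WithLp.toLp 2 (x k, y k) - WithLp.toLp 2 p‖) atTop (𝓝 0)) := by
  have hf' := hf.toIsProperConvexLsc
  have hg' := hg.toIsProperConvexLsc
  refine ⟨PrimalDualJoint.existsUnique_isMinNormSolution hf' hg' hsaddle, fun p hp => ?_⟩
  obtain ⟨v, hv, hfeas, hlow⟩ := hsaddle.exists_value hf' hg'
  have hiff := fun q : X × Y =>
    PrimalDualJoint.mem_nearOptimalSet_zero_iff (p := q) hv hfeas hlow
  have hp0 := (hiff p).2 hp.1
  have hpv : f p.1 + g p.2 = v := by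
    refine le_antisymm ((hp.1.2 xs ys hfeas).trans hv.le) ?_
    have := hlow p.1 p.2
    rwa [PrimalDualJoint.lagrangian, hp.1.1, sub_self, inner_zero_right, EReal.coe_zero,
      add_zero] at this
  obtain ⟨hnear, hout⟩ := halg.asymptotics hf hg hμf hμg hδ hγ hδγ hβpos hβmono hβlim hαpos hαβ
    hεanti hαε hβε hlow hpv hp.1.1
  have hsq : ∀ q : X × Y, ‖WithLp.toLp 2 q‖ ^ 2 = ‖q.1‖ ^ 2 + ‖q.2‖ ^ 2 := fun q =>
    WithLp.prod_norm_sq_eq_of_L2 _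
  set u : ℕ → WithLp 2 (X × Y) := fun k => WithLp.toLp 2 (x k, y k) with hu
  have hconv : ∀ φ : Filter ℕ, φ ≤ atTop →
      (∀ η > 0, ∀ᶠ k in φ, ‖u k‖ ^ 2 ≤ ‖WithLp.toLp 2 p‖ ^ 2 + η) →
      Tendsto u φ (𝓝 (WithLp.toLp 2 p)) := by
    intro φ hφ hnorm
    refine PrimalDualJoint.tendsto_of_eventually_mem_nested
      (C := fun n : ℕ => PrimalDualJoint.nearOptimalSet f g A B b ls v (1 / (n + 1)))
      (fun m n hmn => PrimalDualJoint.nearOptimalSet_mono ls v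
        (Nat.one_div_le_one_div hmn))
      (fun n => PrimalDualJoint.isClosed_nearOptimalSet hf' hg' ls v _)
      (fun n => PrimalDualJoint.convex_nearOptimalSet hf' hg' ls v _)
      (fun n => PrimalDualJoint.nearOptimalSet_mono ls v (by positivity) hp0)
      (fun q hq => hp.2 q.ofLp
        ((hiff q.ofLp).1 (PrimalDualJoint.mem_nearOptimalSet_zero_of_forall hq)))
      (fun n => hφ (hnear _ (by positivity))) hnorm
  have houtside : (∀ᶠ k in atTop, ‖WithLp.toLp 2 p‖ ≤ ‖u k‖) →
      Tendsto u atTop (𝓝 (WithLp.toLp 2 p)) := by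
    intro ho
    refine hconv _ le_rfl fun η hη => ?_
    simp only [hu, hsq]
    refine hout (ho.mono fun k hk => ?_) η hη
    rw [← hsq p, ← hsq (x k, y k)]
    gcongr
  have hinside : ∀ φ : Filter ℕ, φ ≤ atTop → (∀ᶠ k in φ, ‖u k‖ < ‖WithLp.toLp 2 p‖) →
      Tendsto u φ (𝓝 (WithLp.toLp 2 p)) := by
    intro φ hφ hin
    refine hconv φ hφ fun η hη => hin.mono fun k hk => ?_
    have : ‖u k‖ ^ 2 ≤ ‖WithLp.toLp 2 p‖ ^ 2 := by gcongr
    linarith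
  constructor
  · -- If the iterates visit the open ball infinitely often, they converge along these visits.
    obtain ⟨φ, hne, hφ, hlim⟩ : ∃ φ : Filter ℕ, φ.NeBot ∧ φ ≤ atTop ∧
        Tendsto u φ (𝓝 (WithLp.toLp 2 p)) := by
      by_cases hfr : ∃ᶠ k in atTop, ‖u k‖ < ‖WithLp.toLp 2 p‖
      · exact ⟨atTop ⊓ 𝓟 {k | ‖u k‖ < ‖WithLp.toLp 2 p‖}, frequently_iff_neBot.1 hfr, inf_le_left,
          hinside _ inf_le_left (mem_inf_of_right (mem_principal_self _))⟩
      · exact ⟨atTop, inferInstance, le_rfl,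
          houtside ((not_frequently.1 hfr).mono fun k hk => not_lt.1 hk)⟩
    have hlim0 : Tendsto (fun k => ‖u k - WithLp.toLp 2 p‖ₑ) φ (𝓝 0) := by
      have := (hlim.sub_const (WithLp.toLp 2 p)).enorm
      rwa [sub_self, enorm_zero] at this
    exact le_antisymm ((liminf_le_liminf_of_le hφ).trans hlim0.liminf_eq.le) bot_le
  · rintro (⟨K, -, hK⟩ | ⟨K, -, hK⟩)
    · refine tendsto_iff_norm_sub_tendsto_zero.1 (hinside atTop le_rfl ?_)
      exact (eventually_ge_atTop K).mono fun k hk => mem_ball_zero_iff.1 (hK k hk)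
    · refine tendsto_iff_norm_sub_tendsto_zero.1 (houtside ?_)
      exact (eventually_ge_atTop K).mono fun k hk =>
        not_lt.1 fun hlt => hK k hk (mem_ball_zero_iff.2 hlt)
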